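/- Let $\mathbb S^2\subset\mathbb R^3$ be the unit sphere with its surface measure, and for pairwise distinct points $p_1,\dots,p_N\in\mathbb S^2$ let $$\mathcal E(p_1,\dots,p_N)=\sum_{i\neq j}\ln\frac1{\|p_i-p_j\|}$$ (sum over ordered pairs, Euclidean norm) be their logarithmic energy. Let $m_N$ be the minimum of $\mathcal E$ over all configurations of $N$ pairwise distinct points of $\mathbb S^2$, and let $$\kappa=\frac1{\mathrm{vol}(\mathbb S^2)^2}\int_{\mathbb S^2\times\mathbb S^2}\ln\frac1{\|p-q\|}\,dp\,dq$$ be the continuous energy. Then the following hold. (i) The integral defining $\kappa$ converges absolutely and $\kappa=\frac12-\ln 2$. (ii) There is a sequence of real numbers $r_N$, depending only on $N$, with $r_N=o(N)$ as $N\to\infty$, such that for every $N$ and all pairwise distinct $p_1,\dots,p_N\in\mathbb S^2$, $$\mathcal E(p_1,\dots,p_N)\ \ge\ \kappa N^2-\tfrac12N\ln N+\left(\ln2-\tfrac34\right)N+r_N$$ (with $N\ln N=0$ for $N=0$). (iii) Consequently $C_{\log}\ge\ln2-\frac34$: if $C_{\log}$ is a real number such that $m_N=\kappa N^2-\frac12N\ln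 N+C_{\log}N+o(N)$ as $N\to\infty$, then $C_{\log}\ge\ln 2-\frac34$. -/

import Mathlib

namespace LogEnergy

/-- The unit sphere of three-dimensional Euclidean space. -/
abbrev S2 : Type := Metric.sphere (0 : EuclideanSpace ℝ (Fin 3)) 1

/-- The surface measure of the unit sphere (of total mass `4π`). -/
noncomputable def surface : MeasureTheory.Measure S2 :=
  (MeasureTheory.volume : MeasureTheory.Measure (EuclideanSpace ℝ (Fin 3))).toSphere

/-- The logarithmic kernel `ln (1 / ‖p - q‖)`, where `‖·‖` is the Euclidean norm of the
ambient space. -/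
noncomputable def kernel (p q : S2) : ℝ :=
  Real.log (1 / ‖(p : EuclideanSpace ℝ (Fin 3)) - (q : EuclideanSpace ℝ (Fin 3))‖)

/-- The logarithmic energy of `N` points: the sum of the kernel over the ordered pairs `i ≠ j`.
It has its usual meaning when the points are pairwise distinct. -/
noncomputable def energy {N : ℕ} (p : Fin N → S2) : ℝ :=
  ∑ i : Fin N, ∑ j ∈ Finset.univ.filter (fun j : Fin N => j ≠ i), kernel (p i) (p j)

/-- The continuous energy: the mean of the logarithmic kernel over the product of the sphere
with itself. -/
noncomputable def kappa : ℝ :=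
  1 / (surface.real Set.univ) ^ 2 * ∫ z : S2 × S2, kernel z.1 z.2 ∂(surface.prod surface)

/-- The set of the energies of the configurations of `N` pairwise distinct points
(configurations with coinciding points have infinite energy). -/
def energies (N : ℕ) : Set ℝ :=
  {e | ∃ p : Fin N → S2, Function.Injective p ∧ energy p = e}

/-- The minimal logarithmic energy of `N` points; `isLeast_minEnergy` shows that this infimum
is a minimum. -/
noncomputable def minEnergy (N : ℕ) : ℝ := sInf (energies N)

/-- `C` is the coefficient of `N` in the asymptotic expansion
`m_N = κ N² - (1/2) N ln N + C N + o(N)` of the minimal energy, i.e. `C = C_log`. -/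
def IsClog (C : ℝ) : Prop :=
  (fun N : ℕ => minEnergy N -
      (kappa * (N : ℝ) ^ 2 - 1 / 2 * (N : ℝ) * Real.log N + C * N))
    =o[Filter.atTop] (fun N : ℕ => (N : ℝ))

theorem infinite_S2 : Infinite S2 := by
  have hc : IsPreconnected (Metric.sphere (0 : EuclideanSpace ℝ (Fin 3)) 1) := by
    apply isPreconnected_sphere
    rw [← Module.finrank_eq_rank]
    simp
  have hn : (Metric.sphere (0 : EuclideanSpace ℝ (Fin 3)) 1).Nontrivial := by
    refine ⟨EuclideanSpace.single 0 1, by simp, EuclideanSpace.single 0 (-1), by simp, ?_⟩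
    intro h
    have := congrArg (fun v : EuclideanSpace ℝ (Fin 3) => v 0) h
    norm_num at this
  exact (hc.infinite_of_nontrivial hn).to_subtype

/-- The minimum of the energy over configurations of distinct points is attained. -/
theorem isLeast_minEnergy (N : ℕ) : IsLeast (energies N) (minEnergy N) := by
  classical
  let P : (Fin N → S2) → ℝ := fun p => ∏ i : Fin N,
    ∏ j ∈ Finset.univ.filter (fun j : Fin N => j ≠ i),
      ‖(p i : EuclideanSpace ℝ (Fin 3)) - (p j : EuclideanSpace ℝ (Fin 3))‖
  have hP : Continuous P := by fun_prop
  have pos : ∀ p : Fin N → S2, Function.Injective p → 0 < P p := by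
    intro p hp
    refine Finset.prod_pos fun i _ => Finset.prod_pos fun j hj => ?_
    rw [norm_pos_iff, sub_ne_zero]
    intro h
    exact (Finset.mem_filter.1 hj).2 (hp (Subtype.ext h)).symm
  have inj : ∀ p : Fin N → S2, 0 < P p → Function.Injective p := by
    intro p hp i j hij
    by_contra hne
    apply hp.ne'
    refine Finset.prod_eq_zero (Finset.mem_univ i) ?_
    refine Finset.prod_eq_zero (i := j) (by simp [Ne.symm hne]) ?_
    simp [hij]
  have hE : ∀ p : Fin N → S2, Function.Injective p → energy p = -Real.log (P p) := by
    intro p hp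
    have hne : ∀ i j : Fin N, j ≠ i →
        ‖(p i : EuclideanSpace ℝ (Fin 3)) - (p j : EuclideanSpace ℝ (Fin 3))‖ ≠ 0 := by
      intro i j hj h
      rw [norm_eq_zero, sub_eq_zero] at h
      exact hj (hp (Subtype.ext h)).symm
    simp only [P, energy, kernel]
    rw [Real.log_prod, ← Finset.sum_neg_distrib]
    · refine Finset.sum_congr rfl fun i _ => ?_
      rw [Real.log_prod, ← Finset.sum_neg_distrib]
      · refine Finset.sum_congr rfl fun j _ => ?_
        rw [one_div, Real.log_inv]
      · intro j hj
        exact hne i j (Finset.mem_filter.1 hj).2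
    · intro i _
      exact Finset.prod_ne_zero_iff.2 fun j hj => hne i j (Finset.mem_filter.1 hj).2
  have := infinite_S2
  let e : Fin N → S2 := fun i => Infinite.natEmbedding S2 i
  have he : Function.Injective e := fun i j h =>
    Fin.ext ((Infinite.natEmbedding S2).injective h)
  obtain ⟨q, -, hq⟩ := isCompact_univ.exists_isMaxOn ⟨e, Set.mem_univ e⟩ hP.continuousOn
  have hqi : Function.Injective q := inj q ((pos e he).trans_le (hq (Set.mem_univ e)))
  have hl : IsLeast (energies N) (energy q) := by
    refine ⟨⟨q, hqi, rfl⟩, ?_⟩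
    rintro _ ⟨p, hp, rfl⟩
    rw [hE p hp, hE q hqi]
    exact neg_le_neg (Real.log_le_log (pos p hp) (hq (Set.mem_univ p)))
  have hm : minEnergy N = energy q := hl.csInf_eq
  rw [hm]
  exact hl

end LogEnergy

/-! Smear each point into a uniform cap of area `4π / N`, that is, of height `a = 2 / N`. The sum
`f` of the cap indicators has the total mass of the constant density `1`, so `f - 1` is neutral. On
neutral densities the logarithmic kernel is positive definite (`mutualEnergy_self_nonneg`), and the
potential of `1` is constant; hence the energy of `f` is at least that of `1`, which is `(4π)² κ`.

It remains to bound the energy of `f` from above by the discrete one. Per unit mass squared, two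
distinct caps interact by at most the kernel at their centres plus `a / (2 (2 - a))`
(`mutualEnergy_cap_le`); over all ordered pairs these errors add up to exactly `N / 2`. The
self-energy of a cap (`mutualEnergy_cap_self_le`) supplies `(1/2) N ln N`, and the remaining linear
terms combine to `ln 2 - 3/4`.

The cap estimates are one-dimensional: by Archimedes heights are uniformly distributed, and the mean
of the kernel over a circle of latitude is explicit (`integral_log_latitude`). Positivity comes from
the power series of `-log (1 - h)`, whose coefficients are nonnegative, since powers of the inner
product are positive definite. -/

open MeasureTheory Set Real
open scoped ENNReal Pointwise

namespace LogEnergy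

/-! ### Spherical coordinates and Archimedes' theorem -/

/-- The ambient Euclidean space. -/
abbrev E3 : Type := EuclideanSpace ℝ (Fin 3)

/-- The point of Euclidean space with given coordinates in an orthonormal basis. -/
noncomputable def ofCoords (b : OrthonormalBasis (Fin 3) ℝ E3) (z : ℝ × ℝ × ℝ) : E3 :=
  z.1 • b 0 + z.2.1 • b 1 + z.2.2 • b 2

theorem continuous_ofCoords (b : OrthonormalBasis (Fin 3) ℝ E3) : Continuous (ofCoords b) := by
  unfold ofCoords; fun_prop

theorem measurePreserving_ofCoords (b : OrthonormalBasis (Fin 3) ℝ E3) :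
    MeasurePreserving (ofCoords b) := by
  have h1 : MeasurePreserving (fun z : ℝ × ℝ × ℝ => (z.1, MeasurableEquiv.finTwoArrow.symm z.2))
      volume (volume : Measure (ℝ × (Fin 2 → ℝ))) :=
    (MeasurePreserving.id volume).prod (volume_preserving_finTwoArrow ℝ).symm
  have h2 := (volume_preserving_piFinSuccAbove (fun _ : Fin 3 => ℝ) 0).symm
  have h3 := PiLp.volume_preserving_toLp (Fin 3)
  have h4 := b.measurePreserving_repr_symm
  have h := h4.comp (h3.comp (h2.comp h1))
  have he : ofCoords b = b.repr.symm ∘ WithLp.toLp 2 ∘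
      (MeasurableEquiv.piFinSuccAbove (fun _ : Fin 3 => ℝ) 0).symm ∘
      fun z : ℝ × ℝ × ℝ => (z.1, MeasurableEquiv.finTwoArrow.symm z.2) := by
    ext1 z
    simp only [Function.comp_apply]
    rw [← b.sum_repr_symm, Fin.sum_univ_three]
    rfl
  rw [he]
  exact h

theorem inner_ofCoords (b : OrthonormalBasis (Fin 3) ℝ E3) (z w : ℝ × ℝ × ℝ) :
    inner ℝ (ofCoords b z) (ofCoords b w) = z.1 * w.1 + z.2.1 * w.2.1 + z.2.2 * w.2.2 := by
  have h : ∀ i j, inner ℝ (b i) (b j) = if i = j then (1 : ℝ) else 0 :=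
    fun i j => orthonormal_iff_ite.1 b.orthonormal i j
  simp [ofCoords, inner_add_left, inner_add_right, inner_smul_left, inner_smul_right, h]
  ring

/-- The point of the sphere with polar angle `α` and azimuth `θ`. -/
noncomputable def ofAngles (b : OrthonormalBasis (Fin 3) ℝ E3) (α θ : ℝ) : S2 :=
  ⟨ofCoords b (cos α, sin α * cos θ, sin α * sin θ), by
    have h := inner_ofCoords b (cos α, sin α * cos θ, sin α * sin θ)
      (cos α, sin α * cos θ, sin α * sin θ)
    rw [real_inner_self_eq_norm_sq] at h
    rw [mem_sphere_zero_iff_norm, ← sq_eq_sq₀ (norm_nonneg _) zero_le_one, h]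
    simp only
    linear_combination (sin α) ^ 2 * sin_sq_add_cos_sq θ + sin_sq_add_cos_sq α⟩

theorem continuous_ofAngles (b : OrthonormalBasis (Fin 3) ℝ E3) :
    Continuous (fun z : ℝ × ℝ => ofAngles b z.1 z.2) := by
  refine Continuous.subtype_mk ?_ _
  exact (continuous_ofCoords b).comp (by fun_prop)

/-- The point of the sphere with height `t` and azimuth `θ`. -/
noncomputable def ofHeight (b : OrthonormalBasis (Fin 3) ℝ E3) (z : ℝ × ℝ) : S2 :=
  ofAngles b (arccos z.1) z.2

theorem continuous_ofHeight (b : OrthonormalBasis (Fin 3) ℝ E3) : Continuous (ofHeight b) :=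
  Continuous.comp (g := fun z : ℝ × ℝ => ofAngles b z.1 z.2)
    (f := fun z : ℝ × ℝ => (arccos z.1, z.2)) (continuous_ofAngles b)
    ((continuous_arccos.comp continuous_fst).prodMk continuous_snd)

/-- The product measure on heights and azimuths. -/
noncomputable def heightMeasure : Measure (ℝ × ℝ) :=
  (volume.restrict (Ioo (-1) 1)).prod (volume.restrict (Ioo (-π) π))

/-- `toSphere` measures `s` by three times the volume of this cone; the equivalence splits the
cone's indicator into a radial and an angular factor. -/
theorem mem_cone_iff (s : Set S2) (r : ℝ) (hr : 0 < r) (u : S2) :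
    r • (u : E3) ∈ (Ioo (0 : ℝ) 1 • ((↑) '' s : Set E3)) ↔ r < 1 ∧ u ∈ s := by
  constructor
  · rintro ⟨c, hc, _, ⟨v, hv, rfl⟩, h⟩
    have hn : ‖c • (v : E3)‖ = ‖r • (u : E3)‖ := congrArg _ h
    simp only [norm_smul, norm_eq_of_mem_sphere, mul_one, Real.norm_eq_abs, abs_of_pos hr,
      abs_of_pos hc.1] at hn
    subst hn
    have : v = u := Subtype.ext (smul_right_injective _ hr.ne' h)
    exact ⟨hc.2, this ▸ hv⟩
  · rintro ⟨h1, h2⟩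
    exact ⟨r, ⟨hr, h1⟩, u, ⟨u, h2, rfl⟩, rfl⟩

theorem measurableSet_cone {s : Set S2} (hs : MeasurableSet s) :
    MeasurableSet (Ioo (0 : ℝ) 1 • ((↑) '' s : Set E3)) := by
  have h : (Ioo (0 : ℝ) 1 • ((↑) '' s : Set E3)) =
      (↑) '' (homeomorphUnitSphereProd E3 ⁻¹' s ×ˢ Iio ⟨1, mem_Ioi.2 one_pos⟩) := by
    rw [← image2_smul, image2_image_right, ← Homeomorph.image_symm, image_image,
      show Ioo (0 : ℝ) 1 = Subtype.val '' Iio (⟨1, mem_Ioi.2 one_pos⟩ : Ioi (0 : ℝ)) from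
        (image_subtype_val_Ioi_Iio (a := (0 : ℝ)) ⟨1, mem_Ioi.2 one_pos⟩).symm, image2_image_left, image2_swap, ← image_prod]
    rfl
  rw [h]
  refine MeasurableSet.subtype_image (measurableSet_singleton _).compl ?_
  exact (homeomorphUnitSphereProd E3).measurable (hs.prod measurableSet_Iio)

/-- Substitution `t = cos α`. Polar coordinates let `α` run over `(-π, π)`, but `ENNReal.ofReal (sin
α)` vanishes on the nonpositive half. -/
theorem lintegral_sin_mul (H : ℝ → ℝ≥0∞) :
    ∫⁻ α in Ioo (-π) π, ENNReal.ofReal (sin α) * H α = ∫⁻ t in Ioo (-1) 1, H (arccos t) := by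
  have himg : cos '' Ioo 0 π = Ioo (-1) 1 := by
    ext t
    constructor
    · rintro ⟨α, hα, rfl⟩
      have h := sin_pos_of_mem_Ioo hα
      constructor <;> nlinarith [sin_sq_add_cos_sq α]
    · intro ht
      exact ⟨arccos t, ⟨arccos_pos.2 ht.2, by
        rw [lt_iff_le_and_ne]; exact ⟨arccos_le_pi _, by
          intro h; have := arccos_eq_pi.1 h; linarith [ht.1]⟩⟩, cos_arccos ht.1.le ht.2.le⟩
  rw [← himg, lintegral_image_eq_lintegral_abs_deriv_mul measurableSet_Ioo
    (fun x _ => (hasDerivAt_cos x).hasDerivWithinAt)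
    (injOn_cos.mono Ioo_subset_Icc_self)]
  have h1 : Ioo 0 π ⊆ Ioo (-π) π := Ioo_subset_Ioo_left (by linarith [pi_pos])
  rw [← lintegral_indicator measurableSet_Ioo, ← lintegral_indicator measurableSet_Ioo]
  congr 1
  ext α
  by_cases h : α ∈ Ioo 0 π
  · rw [indicator_of_mem (h1 h), indicator_of_mem h, abs_neg, abs_of_pos (sin_pos_of_mem_Ioo h),
      arccos_cos h.1.le h.2.le]
  · rw [indicator_of_notMem h]
    by_cases h' : α ∈ Ioo (-π) π
    · rw [indicator_of_mem h']
      have : α ≤ 0 := by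
        by_contra h0
        exact h ⟨not_le.1 h0, h'.2⟩
      rw [ENNReal.ofReal_of_nonpos (sin_nonpos_of_nonpos_of_neg_pi_le this h'.1.le), zero_mul]
    · rw [indicator_of_notMem h']

/-- The radial factor, which cancels the dimension `3` in `toSphere`. -/
theorem lintegral_sq_unit :
    ∫⁻ r in Ioi (0 : ℝ), ENNReal.ofReal r * ENNReal.ofReal r * (if r < 1 then 1 else 0) = 3⁻¹ := by
  have h : ∀ r ∈ Ioi (0 : ℝ), ENNReal.ofReal r * ENNReal.ofReal r * (if r < 1 then 1 else 0) =
      (Ioo (0 : ℝ) 1).indicator (fun r => ENNReal.ofReal (r ^ 2)) r := by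
    intro r hr
    by_cases h1 : r < 1
    · rw [indicator_of_mem (show r ∈ Ioo (0 : ℝ) 1 from ⟨hr, h1⟩), if_pos h1, mul_one, ← ENNReal.ofReal_mul (le_of_lt hr), sq]
    · rw [indicator_of_notMem (fun h => h1 h.2), if_neg h1, mul_zero]
  rw [setLIntegral_congr_fun measurableSet_Ioi h, lintegral_indicator measurableSet_Ioo,
    Measure.restrict_restrict measurableSet_Ioo, inter_eq_left.2 Ioo_subset_Ioi_self,
    Measure.restrict_congr_set Ioo_ae_eq_Ioc,
    ← ofReal_integral_eq_lintegral_ofReal, ← intervalIntegral.integral_of_le zero_le_one]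
  · rw [integral_pow]
    norm_num
    rw [ENNReal.ofReal_div_of_pos (by norm_num)]; simp
  · exact (by fun_prop : Continuous fun r : ℝ => r ^ 2).integrableOn_Ioc
  · exact Filter.Eventually.of_forall fun r => sq_nonneg r

/-- Lebesgue measure in spherical coordinates, for functions `f (z, ρ, θ)` of the cylindrical
coordinates. -/
theorem lintegral_spherical (b : OrthonormalBasis (Fin 3) ℝ E3) {f : E3 → ℝ≥0∞}
    (hf : Measurable f) :
    ∫⁻ x, f x = ∫⁻ p in polarCoord.target, ENNReal.ofReal p.1 * (ENNReal.ofReal (p.1 * sin p.2) *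
      ∫⁻ θ in Ioo (-π) π, f (ofCoords b
        (p.1 * cos p.2, p.1 * sin p.2 * cos θ, p.1 * sin p.2 * sin θ))) := by
  have hm : Measurable (fun z => f (ofCoords b z)) := hf.comp (continuous_ofCoords b).measurable
  have hc : Measurable fun q : (ℝ × ℝ) × ℝ =>
      f (ofCoords b (q.1.1, q.1.2 * cos q.2, q.1.2 * sin q.2)) := hm.comp (by fun_prop)
  have hG : Measurable fun p : ℝ × ℝ => ENNReal.ofReal p.2 * ∫⁻ θ in Ioo (-π) π,
      f (ofCoords b (p.1, p.2 * cos θ, p.2 * sin θ)) :=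
    Measurable.mul (by fun_prop) (Measurable.lintegral_prod_right' hc)
  rw [← (measurePreserving_ofCoords b).lintegral_comp hf, Measure.volume_eq_prod,
    lintegral_prod _ hm.aemeasurable]
  -- Polar coordinates in the plane orthogonal to `b 0`. Since `ENNReal.ofReal ρ` is zero for `ρ ≤
  -- 0`, `ρ` may run over the whole line, so that polar coordinates apply again to `(z, ρ)`.
  have h1 : ∀ z : ℝ, ∫⁻ w : ℝ × ℝ, f (ofCoords b (z, w)) = ∫⁻ ρ : ℝ, ENNReal.ofReal ρ *
      ∫⁻ θ in Ioo (-π) π, f (ofCoords b (z, ρ * cos θ, ρ * sin θ)) := by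
    intro z
    rw [← lintegral_comp_polarCoord_symm]
    simp only [polarCoord_target, polarCoord_symm_apply, smul_eq_mul]
    rw [Measure.volume_eq_prod, ← Measure.prod_restrict, lintegral_prod _ (by
      refine Measurable.aemeasurable ?_
      exact Measurable.mul (by fun_prop) (hm.comp (by fun_prop)))]
    rw [← lintegral_indicator measurableSet_Ioi]
    congr 1
    ext ρ
    by_cases hρ : ρ ∈ Ioi (0 : ℝ)
    · rw [indicator_of_mem hρ]
      dsimp only
      rw [lintegral_const_mul]
      exact hm.comp (by fun_prop)
    · rw [indicator_of_notMem hρ, ENNReal.ofReal_of_nonpos (not_lt.1 hρ), zero_mul]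
  simp only [h1]
  rw [← lintegral_prod _ hG.aemeasurable, ← Measure.volume_eq_prod,
    ← lintegral_comp_polarCoord_symm]
  simp only [polarCoord_symm_apply, smul_eq_mul]

/-- Archimedes: height and azimuth are independent and uniformly distributed on the sphere. -/
theorem measurePreserving_ofHeight (b : OrthonormalBasis (Fin 3) ℝ E3) :
    MeasurePreserving (ofHeight b) heightMeasure surface := by
  refine ⟨(continuous_ofHeight b).measurable, ?_⟩
  ext s hs
  rw [Measure.map_apply (continuous_ofHeight b).measurable hs, surface,
    Measure.toSphere_apply' _ hs, ← lintegral_indicator_one (measurableSet_cone hs),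
    lintegral_spherical b (measurable_one.indicator (measurableSet_cone hs))]
  have hH : Measurable fun α : ℝ => ∫⁻ θ in Ioo (-π) π,
      s.indicator (1 : S2 → ℝ≥0∞) (ofAngles b α θ) := by
    refine Measurable.lintegral_prod_right' (f := fun z : ℝ × ℝ =>
      s.indicator (1 : S2 → ℝ≥0∞) (ofAngles b z.1 z.2)) ?_
    exact (measurable_one.indicator hs).comp (continuous_ofAngles b).measurable
  have h1 : ∀ p ∈ polarCoord.target, ENNReal.ofReal p.1 * (ENNReal.ofReal (p.1 * sin p.2) *
      ∫⁻ θ in Ioo (-π) π, (Ioo (0 : ℝ) 1 • ((↑) '' s : Set E3)).indicator (1 : E3 → ℝ≥0∞)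
        (ofCoords b (p.1 * cos p.2, p.1 * sin p.2 * cos θ, p.1 * sin p.2 * sin θ))) =
      (ENNReal.ofReal p.1 * ENNReal.ofReal p.1 * (if p.1 < 1 then 1 else 0)) *
      (ENNReal.ofReal (sin p.2) * ∫⁻ θ in Ioo (-π) π,
        s.indicator (1 : S2 → ℝ≥0∞) (ofAngles b p.2 θ)) := by
    intro p hp
    have hp0 : 0 < p.1 := hp.1
    have h2 : ∀ θ, (Ioo (0 : ℝ) 1 • ((↑) '' s : Set E3)).indicator (1 : E3 → ℝ≥0∞)
        (ofCoords b (p.1 * cos p.2, p.1 * sin p.2 * cos θ, p.1 * sin p.2 * sin θ)) =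
        (if p.1 < 1 then 1 else 0) * s.indicator (1 : S2 → ℝ≥0∞) (ofAngles b p.2 θ) := by
      intro θ
      have h3 : ofCoords b (p.1 * cos p.2, p.1 * sin p.2 * cos θ, p.1 * sin p.2 * sin θ) =
          p.1 • (ofAngles b p.2 θ : E3) := by
        simp [ofAngles, ofCoords, smul_smul, mul_assoc]
      rw [h3]
      by_cases h4 : p.1 < 1 <;> by_cases h5 : ofAngles b p.2 θ ∈ s <;>
        simp [indicator, mem_cone_iff s p.1 hp0, h4, h5]
    simp only [h2]
    rw [lintegral_const_mul' _ _ (by split_ifs <;> simp), ENNReal.ofReal_mul hp0.le]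
    ring
  rw [setLIntegral_congr_fun polarCoord.open_target.measurableSet h1, polarCoord_target,
    Measure.volume_eq_prod, ← Measure.prod_restrict,
    lintegral_prod_mul (f := fun r : ℝ => ENNReal.ofReal r * ENNReal.ofReal r *
      (if r < 1 then 1 else 0)) (g := fun α : ℝ => ENNReal.ofReal (sin α) *
      ∫⁻ θ in Ioo (-π) π, s.indicator (1 : S2 → ℝ≥0∞) (ofAngles b α θ)) (by
      refine Measurable.aemeasurable ?_
      exact Measurable.mul (by fun_prop)
        (Measurable.ite measurableSet_Iio measurable_const measurable_const))
      (Measurable.aemeasurable (Measurable.mul (by fun_prop) hH)),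
    lintegral_sq_unit, lintegral_sin_mul, ← mul_assoc]
  have h3 : ((Module.finrank ℝ E3 : ℕ) : ℝ≥0∞) * 3⁻¹ = 1 := by
    simp only [finrank_euclideanSpace_fin]
    exact ENNReal.mul_inv_cancel (by norm_num) (by norm_num)
  rw [h3, one_mul, ← lintegral_indicator_one ((continuous_ofHeight b).measurable hs),
    heightMeasure, lintegral_prod _ (measurable_one.indicator
      ((continuous_ofHeight b).measurable hs)).aemeasurable]
  rfl

/-! ### The kernel as a function of the inner product -/

/-- The inner product of two points of the sphere. -/
noncomputable def height (p q : S2) : ℝ := inner ℝ (p : E3) (q : E3)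

theorem height_comm (p q : S2) : height p q = height q p := real_inner_comm _ _

theorem continuous_height : Continuous fun z : S2 × S2 => height z.1 z.2 := by
  unfold height; fun_prop

theorem norm_sub_sq_eq (p q : S2) : ‖(p : E3) - q‖ ^ 2 = 2 - 2 * height p q := by
  rw [norm_sub_sq_real, norm_eq_of_mem_sphere, norm_eq_of_mem_sphere, height]; ring

theorem abs_height_le (p q : S2) : |height p q| ≤ 1 := by
  have h := abs_real_inner_le_norm (p : E3) q
  simpa [height] using h

theorem height_lt_one {p q : S2} (h : p ≠ q) : height p q < 1 := by
  have h1 : 0 < ‖(p : E3) - q‖ := norm_pos_iff.2 (sub_ne_zero.2 fun h2 => h (Subtype.ext h2))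
  have h2 := norm_sub_sq_eq p q
  nlinarith

/-- Also true for `p = q`: both sides are then `0`, because `log 0 = 0`. -/
theorem kernel_eq (p q : S2) : kernel p q = -(log (2 - 2 * height p q) / 2) := by
  rw [kernel, one_div, log_inv, ← norm_sub_sq_eq, log_pow]
  push_cast; ring

theorem kernel_comm (p q : S2) : kernel p q = kernel q p := by
  rw [kernel_eq, kernel_eq, height_comm]

theorem measurable_kernel : Measurable fun z : S2 × S2 => kernel z.1 z.2 := by
  simp only [kernel_eq]
  exact ((measurable_log.comp (measurable_const.sub
    (continuous_height.measurable.const_mul 2))).div_const 2).neg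

theorem exists_basis (p : S2) : ∃ b : OrthonormalBasis (Fin 3) ℝ E3, b 0 = p := by
  obtain ⟨b, hb⟩ := Orthonormal.exists_orthonormalBasis_extension_of_card_eq (𝕜 := ℝ) (E := E3)
    (ι := Fin 3) (by simp) (v := fun _ => (p : E3)) (s := {0}) (by
      rw [orthonormal_iff_ite]
      rintro ⟨i, hi⟩ ⟨j, hj⟩
      rw [mem_singleton_iff] at hi hj
      subst hi; subst hj
      simp)
  exact ⟨b, hb 0 rfl⟩

theorem inner_ofAngles (b : OrthonormalBasis (Fin 3) ℝ E3) (α θ : ℝ) (q : E3) :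
    inner ℝ (ofAngles b α θ : E3) q = cos α * inner ℝ (b 0) q +
      sin α * (cos θ * inner ℝ (b 1) q + sin θ * inner ℝ (b 2) q) := by
  simp only [ofAngles, ofCoords, inner_add_left, real_inner_smul_left]
  ring

theorem height_ofHeight {b : OrthonormalBasis (Fin 3) ℝ E3} {p : S2} (hb : b 0 = p) {t : ℝ}
    (ht : t ∈ Ioo (-1 : ℝ) 1) (θ : ℝ) : height p (ofHeight b (t, θ)) = t := by
  have h : ∀ i j, inner ℝ (b i) (b j) = if i = j then (1 : ℝ) else 0 :=
    fun i j => orthonormal_iff_ite.1 b.orthonormal i j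
  rw [height_comm, height, ofHeight, inner_ofAngles, ← hb, h, h, h]
  simp [cos_arccos ht.1.le ht.2.le]

theorem ae_heightMeasure : ∀ᵐ z ∂heightMeasure, z.1 ∈ Ioo (-1 : ℝ) 1 := by
  rw [heightMeasure, Measure.prod_restrict]
  filter_upwards [ae_restrict_mem (measurableSet_Ioo.prod measurableSet_Ioo)] with z hz
  exact hz.1

/-! ### Means of the kernel over circles of latitude -/

/-- The mean of the logarithmic kernel over a circle of latitude. -/
noncomputable def latitudeMean (t u : ℝ) : ℝ :=
  -(log (max ((1 + t) * (1 - u)) ((1 - t) * (1 + u))) / 2)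

theorem log_add_posLog {A B : ℝ} (hA : 0 < A) (hB : 0 ≤ B) :
    log A + log⁺ (A⁻¹ * B) = log (max (A ^ 2) (B ^ 2)) / 2 := by
  rcases le_or_gt B A with h | h
  · rw [posLog_eq_zero_iff _ |>.2, max_eq_left (by gcongr), log_pow]
    · push_cast; ring
    · rw [abs_of_nonneg (by positivity), inv_mul_le_iff₀ hA]; linarith
  · rw [posLog_eq_log, max_eq_right (by gcongr), log_pow, log_mul (by positivity) (by linarith),
      log_inv]
    · push_cast; ring
    · rw [abs_of_nonneg (by positivity), le_inv_mul_iff₀ hA]; linarith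

/-- The squared distance factors as `|A e^{iθ} - B|²` with `A² = (1 + t)(1 - u)` and `|B|² = (1 -
t)(1 + u)`, and the circle average of `log |A e^{iθ} - B|` is `log (max A |B|)`. -/
theorem integral_log_latitude {t u y w : ℝ} (ht : t ∈ Ioo (-1 : ℝ) 1)
    (h1 : u ^ 2 + y ^ 2 + w ^ 2 = 1) :
    ∫ θ in Ioo (-π) π, -(log (2 - 2 * (t * u + √(1 - t ^ 2) * (cos θ * y + sin θ * w))) / 2) =
      2 * π * latitudeMean t u := by
  have ht1 : 0 < 1 - t := by linarith [ht.2]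
  have ht2 : 0 < 1 + t := by linarith [ht.1]
  have hr : √(1 - t ^ 2) ^ 2 = 1 - t ^ 2 := sq_sqrt (by nlinarith)
  have hu : u ≤ 1 := by nlinarith [sq_nonneg y, sq_nonneg w]
  have hu' : -1 ≤ u := by nlinarith [sq_nonneg y, sq_nonneg w]
  -- For `u = 1` the radius `A` degenerates to `0`, but then the integrand is constant.
  rcases hu.eq_or_lt with rfl | hu
  · have hy : y = 0 := by nlinarith [sq_nonneg y, sq_nonneg w]
    have hw : w = 0 := by nlinarith [sq_nonneg y, sq_nonneg w]
    subst hy; subst hw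
    have h2 : max ((1 + t) * (1 - 1)) ((1 - t) * (1 + 1)) = 2 - 2 * t := by
      rw [max_eq_right] <;> nlinarith
    simp only [latitudeMean, h2, mul_zero, add_zero, mul_one, integral_const, smul_eq_mul,
      measureReal_restrict_apply_univ, volume_real_Ioo_of_le (show -π ≤ π by linarith [pi_pos])]
    ring
  · have hpos : 0 < (1 + t) * (1 - u) := mul_pos ht2 (by linarith)
    set A : ℝ := √((1 + t) * (1 - u)) with hA
    have hA0 : 0 < A := sqrt_pos.2 hpos
    have hA2 : A ^ 2 = (1 + t) * (1 - u) := sq_sqrt hpos.le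
    set r := √(1 - t ^ 2)
    set B : ℂ := ⟨r * y / A, r * w / A⟩ with hB
    have hB2 : ‖B‖ ^ 2 = (1 - t) * (1 + u) := by
      rw [← Complex.normSq_eq_norm_sq, Complex.normSq_apply]
      simp only [hB]
      have : r * y / A * (r * y / A) + r * w / A * (r * w / A) = r ^ 2 * (y ^ 2 + w ^ 2) / A ^ 2 := by
        field_simp
      rw [this, hA2, hr, div_eq_iff hpos.ne']
      linear_combination (1 - t ^ 2) * h1
    have hint : ∀ θ : ℝ, -(log (2 - 2 * (t * u + r * (cos θ * y + sin θ * w))) / 2) =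
        -log ‖circleMap 0 A θ - B‖ := by
      intro θ
      have h3 : ‖circleMap 0 A θ - B‖ ^ 2 = 2 - 2 * (t * u + r * (cos θ * y + sin θ * w)) := by
        rw [← Complex.normSq_eq_norm_sq, Complex.normSq_apply]
        simp only [circleMap_zero, Complex.sub_re, Complex.sub_im, Complex.re_ofReal_mul,
          Complex.im_ofReal_mul, Complex.exp_ofReal_mul_I_re, Complex.exp_ofReal_mul_I_im, hB]
        have e1 : (A * cos θ - r * y / A) * (A * cos θ - r * y / A) +
            (A * sin θ - r * w / A) * (A * sin θ - r * w / A) =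
            A ^ 2 * (sin θ ^ 2 + cos θ ^ 2) + r ^ 2 * (y ^ 2 + w ^ 2) / A ^ 2 -
              2 * r * (cos θ * y + sin θ * w) := by
          field_simp; ring
        have e2 : r ^ 2 * (y ^ 2 + w ^ 2) / A ^ 2 = (1 - t) * (1 + u) := by
          rw [hA2, hr, div_eq_iff hpos.ne']
          linear_combination (1 - t ^ 2) * h1
        rw [e1, e2, sin_sq_add_cos_sq, hA2]
        ring
      rw [← h3, log_pow]; push_cast; ring
    simp only [hint]
    have hper : Function.Periodic (fun θ => log ‖circleMap 0 A θ - B‖) (2 * π) := by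
      intro θ
      simp only [periodic_circleMap 0 A θ]
    have h4 := circleAverage_log_norm_sub_const_eq_log_radius_add_posLog (a := B) (c := 0)
      hA0.ne'
    rw [circleAverage_def, zero_sub, norm_neg, log_add_posLog hA0 (norm_nonneg _), hA2, hB2,
      smul_eq_mul, inv_mul_eq_iff_eq_mul₀ (by positivity)] at h4
    -- By periodicity the average over `[0, 2π]` is carried to `[-π, π]`.
    have h5 := hper.intervalIntegral_add_eq (-π) 0
    rw [zero_add, h4, show -π + 2 * π = π by ring,
      intervalIntegral.integral_of_le (by linarith [pi_pos]), integral_Ioc_eq_integral_Ioo] at h5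
    rw [integral_neg, h5, latitudeMean]
    ring

theorem integral_kernel_latitude {b : OrthonormalBasis (Fin 3) ℝ E3} {p : S2} (hb : b 0 = p)
    (q : S2) {t : ℝ} (ht : t ∈ Ioo (-1 : ℝ) 1) :
    ∫ θ in Ioo (-π) π, kernel (ofHeight b (t, θ)) q = 2 * π * latitudeMean t (height p q) := by
  have h1 := b.sum_sq_norm_inner_right (q : E3)
  rw [Fin.sum_univ_three, norm_eq_of_mem_sphere] at h1
  simp only [Real.norm_eq_abs, sq_abs, one_pow] at h1
  rw [height, ← hb, ← integral_log_latitude ht h1]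
  congr 1
  ext θ
  rw [kernel_eq, height, ofHeight, inner_ofAngles, cos_arccos ht.1.le ht.2.le, sin_arccos]

instance : IsFiniteMeasure heightMeasure := by unfold heightMeasure; infer_instance

instance : IsFiniteMeasure surface := by unfold surface; infer_instance

/-! ### Zonal integrals and the value of `kappa` -/

/-- Integrals of zonal functions. -/
theorem integrable_zonal_iff (p : S2) {h : ℝ → ℝ} (hm : Measurable h) :
    Integrable (fun x => h (height p x)) surface ↔ IntegrableOn h (Ioo (-1) 1) := by
  obtain ⟨b, hb⟩ := exists_basis p
  have hp : Measurable fun x => height p x :=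
    (continuous_height.comp (Continuous.prodMk_right p)).measurable
  have hs : AEStronglyMeasurable (fun x => h (height p x)) surface :=
    (hm.comp hp).aestronglyMeasurable
  rw [← (measurePreserving_ofHeight b).integrable_comp hs]
  have h1 : (fun x => h (height p x)) ∘ ofHeight b =ᵐ[heightMeasure] fun z => h z.1 := by
    filter_upwards [ae_heightMeasure] with z hz
    simp only [Function.comp]
    rw [height_ofHeight hb hz]
  rw [integrable_congr h1, heightMeasure, Integrable.comp_fst_iff, IntegrableOn]
  simp [pi_pos]

theorem integral_zonal (p : S2) {h : ℝ → ℝ} (hm : Measurable h) :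
    ∫ x, h (height p x) ∂surface = 2 * π * ∫ t in Ioo (-1) 1, h t := by
  obtain ⟨b, hb⟩ := exists_basis p
  have hp : Measurable fun x => height p x :=
    (continuous_height.comp (Continuous.prodMk_right p)).measurable
  have hs : AEStronglyMeasurable (fun x => h (height p x)) (heightMeasure.map (ofHeight b)) :=
    (hm.comp hp).aestronglyMeasurable
  rw [← (measurePreserving_ofHeight b).map_eq, integral_map
    (continuous_ofHeight b).aemeasurable hs]
  have h1 : (fun z => h (height p (ofHeight b z))) =ᵐ[heightMeasure] fun z => h z.1 := by
    filter_upwards [ae_heightMeasure] with z hz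
    rw [height_ofHeight hb hz]
  rw [integral_congr_ae h1, heightMeasure, integral_fun_fst, smul_eq_mul,
    measureReal_restrict_apply_univ, volume_real_Ioo_of_le (by linarith [pi_pos])]
  ring

theorem integrableOn_log_kernel :
    IntegrableOn (fun t : ℝ => -(log (2 - 2 * t) / 2)) (Ioo (-1) 1) := by
  have h : IntervalIntegrable (fun t : ℝ => log (2 - 2 * t)) volume (-1) 1 := by
    have h1 : IntervalIntegrable log volume (4 : ℝ) 0 := intervalIntegral.intervalIntegrable_log'
    have h2 := (h1.comp_sub_left 2).comp_mul_left (c := 2)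
    norm_num at h2
    exact h2
  rw [intervalIntegrable_iff_integrableOn_Ioo_of_le (by norm_num)] at h
  exact (h.div_const 2).neg

theorem measurable_log_kernel : Measurable fun t : ℝ => -(log (2 - 2 * t) / 2) := by
  fun_prop

theorem integrable_kernel (q : S2) : Integrable (fun x => kernel q x) surface := by
  simp only [kernel_eq]
  exact (integrable_zonal_iff q measurable_log_kernel).2 integrableOn_log_kernel

theorem integrable_kernel' (q : S2) : Integrable (fun x => kernel x q) surface := by
  simpa only [kernel_comm] using integrable_kernel q

theorem surface_real_univ : surface.real univ = 4 * π := by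
  obtain ⟨b, hb⟩ := exists_basis ⟨EuclideanSpace.single 0 1, by simp⟩
  have h := integral_zonal ⟨EuclideanSpace.single 0 1, by simp⟩ (measurable_const (a := (1 : ℝ)))
  simp at h
  rw [h]; norm_num; ring

theorem integral_log_kernel :
    ∫ t in Ioo (-1 : ℝ) 1, -(log (2 - 2 * t) / 2) = 1 - 2 * log 2 := by
  have h : ∫ t in (-1 : ℝ)..1, log (2 - 2 * t) = 4 * log 2 - 2 := by
    rw [intervalIntegral.integral_comp_sub_mul log (by norm_num : (2 : ℝ) ≠ 0)]
    norm_num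
    rw [show (4 : ℝ) = 2 ^ 2 by norm_num, log_pow]
    push_cast; ring
  rw [integral_neg, integral_div, ← integral_Ioc_eq_integral_Ioo,
    ← intervalIntegral.integral_of_le (by norm_num), h]
  ring

theorem integral_kernel (q : S2) :
    ∫ x, kernel q x ∂surface = 4 * π * (1 / 2 - log 2) := by
  simp only [kernel_eq]
  rw [integral_zonal q measurable_log_kernel, integral_log_kernel]
  ring

/-- By symmetry the integral of `|kernel x ·|` does not depend on `x`, so the iterated integral is
that of a constant. -/
theorem integrable_kernel_prod :
    Integrable (fun z : S2 × S2 => kernel z.1 z.2) (surface.prod surface) := by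
  rw [integrable_prod_iff measurable_kernel.aestronglyMeasurable]
  refine ⟨Filter.Eventually.of_forall fun x => integrable_kernel x, ?_⟩
  have h : ∀ x, ∫ y, ‖kernel x y‖ ∂surface =
      2 * π * ∫ t in Ioo (-1 : ℝ) 1, ‖-(log (2 - 2 * t) / 2)‖ := by
    intro x
    simp only [kernel_eq]
    exact integral_zonal x measurable_log_kernel.norm
  simp only [h]
  exact integrable_const _

theorem integral_kernel_prod :
    ∫ z : S2 × S2, kernel z.1 z.2 ∂(surface.prod surface) = (4 * π) ^ 2 * (1 / 2 - log 2) := by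
  rw [integral_prod _ integrable_kernel_prod]
  simp only [integral_kernel, integral_const, surface_real_univ, smul_eq_mul]
  ring

theorem kappa_eq : kappa = 1 / 2 - log 2 := by
  rw [kappa, integral_kernel_prod, surface_real_univ]
  field_simp

/-! ### Potentials of zonal densities and of caps -/

theorem integrable_latitudeMean (p q : S2) :
    IntegrableOn (fun t => latitudeMean t (height p q)) (Ioo (-1) 1) := by
  obtain ⟨b, hb⟩ := exists_basis p
  have h := (measurePreserving_ofHeight b).integrable_comp
    (integrable_kernel' q).aestronglyMeasurable |>.2 (integrable_kernel' q)
  have h1 := (Integrable.integral_prod_left (f := (fun x => kernel x q) ∘ ofHeight b)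
    h).const_mul (2 * π)⁻¹
  refine (integrable_congr ?_).1 h1
  filter_upwards [ae_restrict_mem measurableSet_Ioo] with t ht
  simp only [Function.comp]
  rw [integral_kernel_latitude hb q ht]
  field_simp

/-- The potential of a zonal density. -/
theorem integral_kernel_mul_zonal (p q : S2) {g : ℝ → ℝ} (hg : Measurable g) {C : ℝ}
    (hC : ∀ t, ‖g t‖ ≤ C) :
    ∫ x, kernel x q * g (height p x) ∂surface =
      2 * π * ∫ t in Ioo (-1) 1, g t * latitudeMean t (height p q) := by
  obtain ⟨b, hb⟩ := exists_basis p
  have hp : Measurable fun x => height p x :=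
    (continuous_height.comp (Continuous.prodMk_right p)).measurable
  have hi : Integrable (fun x => kernel x q * g (height p x)) surface :=
    (integrable_kernel' q).mul_bdd (hg.comp hp).aestronglyMeasurable
      (Filter.Eventually.of_forall fun x => hC _)
  have h : Integrable (fun z => kernel (ofHeight b z) q * g (height p (ofHeight b z)))
      heightMeasure :=
    (measurePreserving_ofHeight b).integrable_comp hi.aestronglyMeasurable |>.2 hi
  rw [← (measurePreserving_ofHeight b).map_eq, integral_map
    (continuous_ofHeight b).aemeasurable (by
      rw [(measurePreserving_ofHeight b).map_eq]; exact hi.aestronglyMeasurable)]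
  rw [heightMeasure, integral_prod _ (by exact h), ← integral_const_mul]
  refine setIntegral_congr_fun measurableSet_Ioo fun t ht => ?_
  simp only [height_ofHeight hb ht]
  rw [integral_mul_const, integral_kernel_latitude hb q ht]
  ring

/-- The indicator function of the spherical cap of height `a` centred at `p`. -/
noncomputable def cap (a : ℝ) (p x : S2) : ℝ := (Ioi (1 - a)).indicator 1 (height p x)

theorem measurable_capProfile (a : ℝ) : Measurable ((Ioi (1 - a)).indicator (1 : ℝ → ℝ)) :=
  measurable_one.indicator measurableSet_Ioi

theorem norm_capProfile_le (a t : ℝ) : ‖(Ioi (1 - a)).indicator (1 : ℝ → ℝ) t‖ ≤ 1 :=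
  (norm_indicator_le_norm_self _ _).trans (by simp)

theorem measurable_cap (a : ℝ) (p : S2) : Measurable (cap a p) :=
  (measurable_capProfile a).comp (continuous_height.comp (Continuous.prodMk_right p)).measurable

theorem cap_nonneg (a : ℝ) (p x : S2) : 0 ≤ cap a p x :=
  indicator_nonneg (fun _ _ => zero_le_one) _

theorem norm_cap_le (a : ℝ) (p x : S2) : ‖cap a p x‖ ≤ 1 := norm_capProfile_le a _

theorem ae_height_mem (p : S2) : ∀ᵐ x ∂surface, height p x ∈ Ioo (-1 : ℝ) 1 := by
  obtain ⟨b, hb⟩ := exists_basis p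
  have hp : Measurable fun x => height p x :=
    (continuous_height.comp (Continuous.prodMk_right p)).measurable
  rw [← (measurePreserving_ofHeight b).map_eq, ae_map_iff (continuous_ofHeight b).aemeasurable
    (hp measurableSet_Ioo)]
  filter_upwards [ae_heightMeasure] with z hz
  rwa [height_ofHeight hb hz]

theorem integral_capProfile_mul {a : ℝ} (ha : a ≤ 2) (f : ℝ → ℝ) :
    ∫ t in Ioo (-1) 1, (Ioi (1 - a)).indicator 1 t * f t = ∫ t in Ioo (1 - a) 1, f t := by
  have h : ∀ t, (Ioi (1 - a)).indicator 1 t * f t = (Ioi (1 - a)).indicator f t := by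
    intro t
    by_cases h : t ∈ Ioi (1 - a) <;> simp [h]
  simp only [h]
  rw [setIntegral_indicator measurableSet_Ioi, Ioo_inter_Ioi, max_eq_right (by linarith)]

theorem integral_cap_mul {a : ℝ} (ha : a ≤ 2) (p : S2) {h : ℝ → ℝ} (hm : Measurable h) :
    ∫ x, cap a p x * h (height p x) ∂surface = 2 * π * ∫ t in Ioo (1 - a) 1, h t := by
  rw [← integral_capProfile_mul ha]
  exact integral_zonal p (h := fun t => (Ioi (1 - a)).indicator 1 t * h t)
    ((measurable_capProfile a).mul hm)

theorem integral_cap {a : ℝ} (ha0 : 0 ≤ a) (ha : a ≤ 2) (p : S2) :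
    ∫ x, cap a p x ∂surface = 2 * π * a := by
  have h := integral_cap_mul ha p (measurable_const (a := (1 : ℝ)))
  simp only [mul_one] at h
  rw [h]
  simp [ha0]

/-- The potential of a cap. -/
noncomputable def capPotential (a : ℝ) (p q : S2) : ℝ :=
  ∫ x, kernel x q * cap a p x ∂surface

theorem capPotential_eq {a : ℝ} (ha : a ≤ 2) (p q : S2) :
    capPotential a p q = 2 * π * ∫ t in Ioo (1 - a) 1, latitudeMean t (height p q) := by
  rw [← integral_capProfile_mul ha]
  exact integral_kernel_mul_zonal p q (measurable_capProfile a) (norm_capProfile_le a)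

/-- Keep only the first term of the maximum. The loss is half of `log (2 / (1 + t)) ≤ (1 - t) / (1 +
t)`, and `1 + t > 2 - a`. -/
theorem latitudeMean_le_left {a t u : ℝ} (ha : a ≤ 1) (ht : t ∈ Ioo (1 - a) 1)
    (hu : u < 1) :
    latitudeMean t u ≤ -(log (2 - 2 * u) / 2) + (1 - t) / (2 * (2 - a)) := by
  have h1 : 0 < 1 + t := by linarith [ht.1]
  have h2 : log ((1 + t) * (1 - u)) ≤ log (max ((1 + t) * (1 - u)) ((1 - t) * (1 + u))) :=
    log_le_log (mul_pos h1 (by linarith)) (le_max_left _ _)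
  rw [log_mul h1.ne' (by linarith)] at h2
  have h3 : log (2 - 2 * u) = log 2 + log (1 - u) := by
    rw [← log_mul (by norm_num) (by linarith)]; ring_nf
  have h4 : log 2 - log (1 + t) ≤ (1 - t) / (2 - a) := by
    rw [← log_div (by norm_num) h1.ne']
    refine (log_le_sub_one_of_pos (by positivity)).trans ?_
    rw [div_sub_one h1.ne', div_le_div_iff₀ h1 (by linarith)]
    nlinarith [ht.1, ht.2]
  have h5 : (1 - t) / (2 * (2 - a)) = (1 - t) / (2 - a) / 2 := by
    rw [div_div, mul_comm]
  rw [latitudeMean, h5, h3]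
  linarith

/-- Inside the cap both `1 + t` and `1 + u` exceed `2 - a`, which can be taken out of the maximum.
-/
theorem latitudeMean_le_right {a t u : ℝ} (ha : a ≤ 1) (ht : t ∈ Ioo (1 - a) 1)
    (hu : u ∈ Ioo (1 - a) 1) :
    latitudeMean t u ≤ -(log (2 - a) / 2) - log (max (1 - t) (1 - u)) / 2 := by
  have hm : 0 < max (1 - t) (1 - u) := lt_max_of_lt_left (by linarith [ht.2])
  have h2 : log ((2 - a) * max (1 - t) (1 - u)) ≤
      log (max ((1 + t) * (1 - u)) ((1 - t) * (1 + u))) := by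
    refine log_le_log (mul_pos (by linarith) hm) ?_
    rw [mul_max_of_nonneg _ _ (by linarith)]
    refine max_le (le_max_of_le_right ?_) (le_max_of_le_left ?_)
    · rw [mul_comm]
      exact mul_le_mul_of_nonneg_left (by linarith [hu.1]) (by linarith [ht.2])
    · exact mul_le_mul_of_nonneg_right (by linarith [ht.1]) (by linarith [hu.2])
  rw [log_mul (by linarith) hm.ne'] at h2
  rw [latitudeMean]
  linarith

theorem integral_one_sub {a : ℝ} (ha0 : 0 ≤ a) :
    ∫ t in Ioo (1 - a) 1, (1 - t) = a ^ 2 / 2 := by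
  rw [← integral_Ioc_eq_integral_Ioo, ← intervalIntegral.integral_of_le (by linarith),
    intervalIntegral.integral_comp_sub_left (fun t => t) 1]
  simp

theorem integrableOn_Ioo_of_continuous {f : ℝ → ℝ} (hf : Continuous f) (a b : ℝ) :
    IntegrableOn f (Ioo a b) :=
  hf.integrableOn_Icc.mono_set Ioo_subset_Icc_self

theorem integral_log_max {a u : ℝ} (ha0 : 0 < a) (hu : u ∈ Ioo (1 - a) 1) :
    IntegrableOn (fun t => log (max (1 - t) (1 - u))) (Ioo (1 - a) 1) ∧
    ∫ t in Ioo (1 - a) 1, log (max (1 - t) (1 - u)) = a * log a - a + (1 - u) := by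
  have hu0 : 0 < 1 - u := by linarith [hu.2]
  have hc : Continuous fun t : ℝ => log (max (1 - t) (1 - u)) := by
    refine Continuous.log (by fun_prop) fun t => ?_
    exact (lt_max_of_lt_right hu0).ne'
  refine ⟨integrableOn_Ioo_of_continuous hc _ _, ?_⟩
  rw [← integral_Ioc_eq_integral_Ioo, ← intervalIntegral.integral_of_le (by linarith),
    ← intervalIntegral.integral_add_adjacent_intervals (b := u) (hc.intervalIntegrable _ _)
      (hc.intervalIntegrable _ _)]
  have h1 : ∫ t in (1 - a)..u, log (max (1 - t) (1 - u)) = ∫ t in (1 - a)..u, log (1 - t) := by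
    refine intervalIntegral.integral_congr fun t ht => ?_
    rw [uIcc_of_le hu.1.le] at ht
    rw [max_eq_left (by linarith [ht.2])]
  have h2 : ∫ t in u..1, log (max (1 - t) (1 - u)) = ∫ t in u..1, log (1 - u) := by
    refine intervalIntegral.integral_congr fun t ht => ?_
    rw [uIcc_of_le hu.2.le] at ht
    rw [max_eq_right (by linarith [ht.1])]
  rw [h1, h2, intervalIntegral.integral_comp_sub_left log 1, integral_log,
    intervalIntegral.integral_const]
  simp only [sub_sub_cancel, smul_eq_mul]
  ring

theorem integrableOn_latitudeMean {a : ℝ} (ha : a ≤ 2) (p q : S2) :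
    IntegrableOn (fun t => latitudeMean t (height p q)) (Ioo (1 - a) 1) :=
  (integrable_latitudeMean p q).mono_set (Ioo_subset_Ioo_left (by linarith))

/-- The potential of a cap is at most that of a point mass at its centre, up to a small error. -/
theorem capPotential_le_kernel {a : ℝ} (ha0 : 0 < a) (ha : a ≤ 1) {p q : S2}
    (h : height p q < 1) :
    capPotential a p q ≤ 2 * π * a * (kernel p q + a / (4 * (2 - a))) := by
  have h1 : ∫ t in Ioo (1 - a) 1, latitudeMean t (height p q) ≤
      ∫ t in Ioo (1 - a) 1, (-(log (2 - 2 * height p q) / 2) + (1 - t) / (2 * (2 - a))) := by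
    refine setIntegral_mono_on (integrableOn_latitudeMean (by linarith) p q) ?_ measurableSet_Ioo
      fun t ht => latitudeMean_le_left ha ht h
    exact integrableOn_Ioo_of_continuous (by fun_prop) _ _
  rw [integral_add (integrableOn_Ioo_of_continuous (by fun_prop) _ _)
    (integrableOn_Ioo_of_continuous (by fun_prop) _ _), integral_div, integral_one_sub ha0.le,
    integral_const, measureReal_restrict_apply_univ, volume_real_Ioo_of_le (by linarith),
    ← kernel_eq] at h1
  rw [capPotential_eq (by linarith)]
  have h2 : (2 - a) ≠ 0 := by linarith
  calc _ ≤ 2 * π * ((1 - (1 - a)) • kernel p q + a ^ 2 / 2 / (2 * (2 - a))) := by gcongr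
    _ = _ := by rw [smul_eq_mul]; field_simp; ring

/-- Keeping the term linear in the height, rather than bounding it by `0`, is what yields the sharp
self-energy below. -/
theorem capPotential_le_of_mem {a : ℝ} (ha0 : 0 < a) (ha : a ≤ 1) {p q : S2}
    (h : height p q ∈ Ioo (1 - a) 1) :
    capPotential a p q ≤ 2 * π * a * (-(log (2 - a) / 2) - log a / 2 + 1 / 2 -
      (1 - height p q) / (2 * a)) := by
  obtain ⟨hi, hl⟩ := integral_log_max ha0 h
  have hconst : IntegrableOn (fun _ : ℝ => -(log (2 - a) / 2)) (Ioo (1 - a) 1) :=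
    integrableOn_Ioo_of_continuous continuous_const _ _
  have h1 : ∫ t in Ioo (1 - a) 1, latitudeMean t (height p q) ≤
      ∫ t in Ioo (1 - a) 1, (-(log (2 - a) / 2) - log (max (1 - t) (1 - height p q)) / 2) := by
    refine setIntegral_mono_on (integrableOn_latitudeMean (by linarith) p q)
      (hconst.sub (hi.div_const 2)) measurableSet_Ioo
      fun t ht => latitudeMean_le_right ha ht h
  rw [integral_sub hconst (hi.div_const 2), integral_div, hl,
    integral_const, measureReal_restrict_apply_univ, volume_real_Ioo_of_le (by linarith)] at h1
  rw [capPotential_eq (by linarith)]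
  calc _ ≤ 2 * π * ((1 - (1 - a)) • (-(log (2 - a) / 2)) -
        (a * log a - a + (1 - height p q)) / 2) := by gcongr
    _ = _ := by rw [smul_eq_mul]; field_simp; ring

/-! ### Mutual energies of caps -/

/-- The mutual energy of two bounded densities. -/
noncomputable def mutualEnergy (f g : S2 → ℝ) : ℝ :=
  ∫ z : S2 × S2, kernel z.1 z.2 * (f z.1 * g z.2) ∂(surface.prod surface)

theorem integrable_mutualEnergy {f g : S2 → ℝ} (hf : Measurable f) (hg : Measurable g) {A B : ℝ}
    (hA : ∀ x, ‖f x‖ ≤ A) (hB : ∀ x, ‖g x‖ ≤ B) :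
    Integrable (fun z : S2 × S2 => kernel z.1 z.2 * (f z.1 * g z.2)) (surface.prod surface) := by
  refine integrable_kernel_prod.mul_bdd (c := A * B)
    ((hf.comp measurable_fst).mul (hg.comp measurable_snd)).aestronglyMeasurable
    (Filter.Eventually.of_forall fun z => ?_)
  rw [norm_mul]
  exact mul_le_mul (hA _) (hB _) (norm_nonneg _) ((norm_nonneg _).trans (hA z.1))

theorem mutualEnergy_cap_eq (a : ℝ) (p q : S2) :
    Integrable (fun y => capPotential a p y * cap a q y) surface ∧
    mutualEnergy (cap a p) (cap a q) = ∫ y, capPotential a p y * cap a q y ∂surface := by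
  have h := integrable_mutualEnergy (measurable_cap a p) (measurable_cap a q)
    (norm_cap_le a p) (norm_cap_le a q)
  have he : ∀ y, ∫ x, kernel x y * (cap a p x * cap a q y) ∂surface =
      capPotential a p y * cap a q y := by
    intro y
    simp only [← mul_assoc]
    rw [integral_mul_const, capPotential]
  refine ⟨?_, ?_⟩
  · have h1 := h.integral_prod_right
    simpa only [he] using h1
  · rw [mutualEnergy, integral_prod_symm _ h]
    simp only [he]

theorem integrable_cap (a : ℝ) (p : S2) : Integrable (cap a p) surface :=
  Integrable.of_bound (measurable_cap a p).aestronglyMeasurable 1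
    (Filter.Eventually.of_forall (norm_cap_le a p))

/-- `capPotential_le_kernel` is used twice: it shrinks the cap at `p` to its centre, then the cap at
`q`. Each use costs `a / (4 * (2 - a))`. The caps may overlap. -/
theorem mutualEnergy_cap_le {a : ℝ} (ha0 : 0 < a) (ha : a ≤ 1) {p q : S2} (hpq : p ≠ q) :
    mutualEnergy (cap a p) (cap a q) ≤
      (2 * π * a) ^ 2 * (kernel p q + 2 * (a / (4 * (2 - a)))) := by
  obtain ⟨hi, he⟩ := mutualEnergy_cap_eq a p q
  set δ := a / (4 * (2 - a))
  have hk : Integrable (fun y => kernel y p * cap a q y) surface :=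
    (integrable_kernel' p).mul_bdd (measurable_cap a q).aestronglyMeasurable
      (Filter.Eventually.of_forall (norm_cap_le a q))
  have hc := (integrable_cap a q).const_mul δ
  rw [he]
  calc ∫ y, capPotential a p y * cap a q y ∂surface
      ≤ ∫ y, 2 * π * a * (kernel y p * cap a q y + δ * cap a q y) ∂surface := by
        refine integral_mono_ae hi ((hk.add hc).const_mul _) ?_
        filter_upwards [ae_height_mem p] with y hy
        have h1 := mul_le_mul_of_nonneg_right (capPotential_le_kernel ha0 ha hy.2)
          (cap_nonneg a q y)
        rw [kernel_comm p y] at h1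
        refine h1.trans (le_of_eq ?_)
        ring
    _ = 2 * π * a * (capPotential a q p + δ * (2 * π * a)) := by
        rw [integral_const_mul, integral_add hk hc, integral_const_mul,
          integral_cap ha0.le (by linarith), capPotential]
    _ ≤ 2 * π * a * (2 * π * a * (kernel q p + δ) + δ * (2 * π * a)) := by
        gcongr
        exact capPotential_le_kernel ha0 ha (height_lt_one hpq.symm)
    _ = _ := by rw [kernel_comm q p]; ring

/-- Over the cap, `1 - height p y` has mean `a / 2`, so the linear term of `capPotential_le_of_mem`
lowers `1 / 2` to `1 / 4`. -/
theorem mutualEnergy_cap_self_le {a : ℝ} (ha0 : 0 < a) (ha : a ≤ 1) (p : S2) :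
    mutualEnergy (cap a p) (cap a p) ≤
      (2 * π * a) ^ 2 * (-(log (2 - a) / 2) - log a / 2 + 1 / 4) := by
  obtain ⟨hi, he⟩ := mutualEnergy_cap_eq a p p
  set e := -(log (2 - a) / 2) - log a / 2 + 1 / 2
  have hm : Measurable fun t : ℝ => 2 * π * a * (e - (1 - t) / (2 * a)) := by fun_prop
  have hp : Measurable fun x => height p x :=
    (continuous_height.comp (Continuous.prodMk_right p)).measurable
  have hi' : Integrable (fun y => cap a p y * (2 * π * a * (e - (1 - height p y) / (2 * a))))
      surface := by
    refine (integrable_zonal_iff p (h := fun t => (Ioi (1 - a)).indicator 1 t *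
      (2 * π * a * (e - (1 - t) / (2 * a)))) ((measurable_capProfile a).mul hm)).2 ?_
    exact (integrableOn_Ioo_of_continuous (by fun_prop) _ _).bdd_mul
      (measurable_capProfile a).aestronglyMeasurable
      (Filter.Eventually.of_forall (norm_capProfile_le a))
  rw [he]
  calc ∫ y, capPotential a p y * cap a p y ∂surface
      ≤ ∫ y, cap a p y * (2 * π * a * (e - (1 - height p y) / (2 * a))) ∂surface := by
        refine integral_mono_ae hi hi' ?_
        filter_upwards [ae_height_mem p] with y hy
        by_cases h : height p y ∈ Ioi (1 - a)
        · have h1 := mul_le_mul_of_nonneg_right (capPotential_le_of_mem ha0 ha ⟨h, hy.2⟩)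
            (cap_nonneg a p y)
          exact h1.trans (le_of_eq (mul_comm _ _))
        · have : cap a p y = 0 := indicator_of_notMem h _
          simp [this]
    _ = 2 * π * ∫ t in Ioo (1 - a) 1, 2 * π * a * (e - (1 - t) / (2 * a)) :=
        integral_cap_mul (by linarith) p hm
    _ = _ := by
        rw [integral_const_mul, integral_sub (integrableOn_Ioo_of_continuous (by fun_prop) _ _)
          (integrableOn_Ioo_of_continuous (by fun_prop) _ _), integral_div,
          integral_one_sub ha0.le, integral_const, measureReal_restrict_apply_univ,
          volume_real_Ioo_of_le (by linarith), smul_eq_mul]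
        simp only [e]
        field_simp
        ring

/-! ### Positive definiteness on neutral densities -/

/-- Bounded measurable functions on the sphere. -/
def BoundedMeasurable (f : S2 → ℝ) : Prop := Measurable f ∧ ∃ C, ∀ x, ‖f x‖ ≤ C

theorem boundedMeasurable_cap (a : ℝ) (p : S2) : BoundedMeasurable (cap a p) :=
  ⟨measurable_cap a p, 1, norm_cap_le a p⟩

theorem boundedMeasurable_const (c : ℝ) : BoundedMeasurable fun _ => c :=
  ⟨measurable_const, ‖c‖, fun _ => le_rfl⟩

theorem boundedMeasurable_coord (i : Fin 3) : BoundedMeasurable fun x => (x : E3) i := by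
  refine ⟨by fun_prop, 1, fun x => ?_⟩
  exact (PiLp.norm_apply_le (x : E3) i).trans (norm_eq_of_mem_sphere x).le

theorem BoundedMeasurable.mul {f g : S2 → ℝ} (hf : BoundedMeasurable f)
    (hg : BoundedMeasurable g) : BoundedMeasurable fun x => f x * g x := by
  obtain ⟨hf, A, hA⟩ := hf
  obtain ⟨hg, B, hB⟩ := hg
  refine ⟨hf.mul hg, A * B, fun x => ?_⟩
  rw [norm_mul]
  exact mul_le_mul (hA _) (hB _) (norm_nonneg _) ((norm_nonneg _).trans (hA x))

theorem BoundedMeasurable.sub {f g : S2 → ℝ} (hf : BoundedMeasurable f)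
    (hg : BoundedMeasurable g) : BoundedMeasurable fun x => f x - g x := by
  obtain ⟨hf, A, hA⟩ := hf
  obtain ⟨hg, B, hB⟩ := hg
  exact ⟨hf.sub hg, A + B, fun x => (norm_sub_le _ _).trans (add_le_add (hA x) (hB x))⟩

theorem BoundedMeasurable.sum {ι : Type*} (s : Finset ι) {f : ι → S2 → ℝ}
    (hf : ∀ i, BoundedMeasurable (f i)) : BoundedMeasurable fun x => ∑ i ∈ s, f i x := by
  choose hm C hC using hf
  exact ⟨Finset.measurable_sum _ fun i _ => hm i, ∑ i ∈ s, C i, fun x =>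
    (norm_sum_le _ _).trans (Finset.sum_le_sum fun i _ => hC i x)⟩

theorem BoundedMeasurable.integrable {f : S2 → ℝ} (hf : BoundedMeasurable f) :
    Integrable f surface := by
  obtain ⟨hf, A, hA⟩ := hf
  exact Integrable.of_bound hf.aestronglyMeasurable A (Filter.Eventually.of_forall hA)

theorem BoundedMeasurable.integrable_mutualEnergy {f g : S2 → ℝ} (hf : BoundedMeasurable f)
    (hg : BoundedMeasurable g) :
    Integrable (fun z : S2 × S2 => kernel z.1 z.2 * (f z.1 * g z.2)) (surface.prod surface) := by
  obtain ⟨hf, A, hA⟩ := hf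
  obtain ⟨hg, B, hB⟩ := hg
  exact LogEnergy.integrable_mutualEnergy hf hg hA hB

theorem norm_pow_height_le (n : ℕ) (p q : S2) : ‖height p q ^ n‖ ≤ 1 := by
  rw [norm_pow]
  exact pow_le_one₀ (norm_nonneg _) (abs_height_le p q)

theorem integrable_pow_height_mul (n : ℕ) {f g : S2 → ℝ} (hf : BoundedMeasurable f)
    (hg : BoundedMeasurable g) :
    Integrable (fun z : S2 × S2 => height z.1 z.2 ^ n * (f z.1 * g z.2))
      (surface.prod surface) :=
  (hf.integrable.mul_prod hg.integrable).bdd_mul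
    (continuous_height.pow n).aestronglyMeasurable
    (Filter.Eventually.of_forall fun z => norm_pow_height_le n z.1 z.2)

/-- Powers of the inner product are positive definite kernels. -/
theorem integral_pow_height_nonneg (n : ℕ) {w : S2 → ℝ} (hw : BoundedMeasurable w) :
    0 ≤ ∫ z : S2 × S2, height z.1 z.2 ^ n * (w z.1 * w z.2) ∂(surface.prod surface) := by
  induction n generalizing w with
  | zero =>
    simp only [pow_zero, one_mul]
    rw [integral_prod_mul]
    exact mul_self_nonneg _
  | succ n ih =>
    -- One factor of the inner product is expanded in coordinates, and each coordinate is absorbed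
    -- into the weight; hence the induction over all `w`.
    have h : ∀ z : S2 × S2, height z.1 z.2 ^ (n + 1) * (w z.1 * w z.2) =
        ∑ i : Fin 3, height z.1 z.2 ^ n *
          (((z.1 : E3) i * w z.1) * ((z.2 : E3) i * w z.2)) := by
      intro z
      have : height z.1 z.2 = ∑ i : Fin 3, (z.1 : E3) i * (z.2 : E3) i := by
        rw [height, PiLp.inner_apply]
        exact Finset.sum_congr rfl fun i _ => mul_comm _ _
      rw [pow_succ, mul_assoc, ← Finset.mul_sum]
      conv_lhs => rw [this]
      conv_rhs => rw [this]
      rw [Finset.sum_mul]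
      congr 1
      exact Finset.sum_congr rfl fun i _ => by ring
    simp only [h]
    have hc := fun i => (boundedMeasurable_coord i).mul hw
    rw [integral_finsetSum _ fun i _ => integrable_pow_height_mul n (hc i) (hc i)]
    exact Finset.sum_nonneg fun i _ => ih (hc i)

/-- The series `∑ (s h)^(n+1) / (n+1)` has nonnegative coefficients; the damping `s < 1` gives a
geometric bound, so it can be integrated term by term. -/
theorem integral_neg_log_nonneg {s : ℝ} (hs0 : 0 ≤ s) (hs : s < 1) {w : S2 → ℝ}
    (hw : BoundedMeasurable w) :
    0 ≤ ∫ z : S2 × S2, -log (1 - s * height z.1 z.2) * (w z.1 * w z.2)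
      ∂(surface.prod surface) := by
  have hw' := hw
  obtain ⟨hm, C, hC⟩ := hw
  have habs : ∀ z : S2 × S2, |s * height z.1 z.2| ≤ s := by
    intro z
    rw [abs_mul, abs_of_nonneg hs0]
    exact mul_le_of_le_one_right hs0 (abs_height_le _ _)
  have h := hasSum_integral_of_dominated_convergence (μ := surface.prod surface)
    (F := fun (n : ℕ) (z : S2 × S2) => (s * height z.1 z.2) ^ (n + 1) / (n + 1) *
      (w z.1 * w z.2))
    (f := fun z => -log (1 - s * height z.1 z.2) * (w z.1 * w z.2))
    (fun n _ => s ^ (n + 1) * (C * C)) ?_ ?_ ?_ ?_ ?_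
  · refine h.nonneg fun n => ?_
    have h1 : ∀ z : S2 × S2, (s * height z.1 z.2) ^ (n + 1) / (n + 1) * (w z.1 * w z.2) =
        s ^ (n + 1) / (n + 1) * (height z.1 z.2 ^ (n + 1) * (w z.1 * w z.2)) := by
      intro z; rw [mul_pow]; ring
    simp only [h1]
    rw [integral_const_mul]
    exact mul_nonneg (by positivity) (integral_pow_height_nonneg _ hw')
  · intro n
    exact (((((continuous_const.mul continuous_height).pow _).div_const _).measurable).mul
      ((hm.comp measurable_fst).mul (hm.comp measurable_snd))).aestronglyMeasurable
  · intro n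
    refine Filter.Eventually.of_forall fun z => ?_
    rw [norm_mul, norm_mul, norm_div, norm_pow]
    refine mul_le_mul ?_ (mul_le_mul (hC _) (hC _) (norm_nonneg _)
      ((norm_nonneg _).trans (hC z.1))) (by positivity) (by positivity)
    have h2 : (1 : ℝ) ≤ ‖(n : ℝ) + 1‖ := by
      rw [Real.norm_of_nonneg (by positivity)]
      linarith [Nat.cast_nonneg (α := ℝ) n]
    exact (div_le_self (by positivity) h2).trans
      (pow_le_pow_left₀ (norm_nonneg _) (habs z) _)
  · refine Filter.Eventually.of_forall fun z => ?_
    exact (((summable_geometric_of_lt_one hs0 hs).mul_left s).congr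
      fun n => (pow_succ' s n).symm).mul_right _
  · exact integrable_const _
  · exact Filter.Eventually.of_forall fun z =>
      (hasSum_pow_div_log_of_abs_lt_one ((habs z).trans_lt hs)).mul_right _

theorem ae_height_lt_one : ∀ᵐ z ∂(surface.prod surface), height z.1 z.2 < 1 := by
  have hm : MeasurableSet {z : S2 × S2 | height z.1 z.2 < 1} :=
    measurableSet_lt continuous_height.measurable measurable_const
  refine (Measure.ae_prod_mem_iff_ae_ae_mem hm).2 (Filter.Eventually.of_forall fun x => ?_)
  filter_upwards [ae_height_mem x] with y hy using hy.2

theorem kernel_eq_log {p q : S2} (h : height p q < 1) :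
    kernel p q = -(log 2 / 2) + -log (1 - height p q) / 2 := by
  rw [kernel_eq, show 2 - 2 * height p q = 2 * (1 - height p q) by ring,
    log_mul (by norm_num) (by linarith)]
  ring

/-- A bound independent of `s`, for dominated convergence as `s` tends to `1`. -/
theorem norm_log_le {s h : ℝ} (hs0 : 0 ≤ s) (hs : s ≤ 1) (h0 : -1 ≤ h) (h1 : h < 1) :
    ‖-log (1 - s * h)‖ ≤ log 2 + ‖-log (1 - h)‖ := by
  have hl2 : 0 ≤ log 2 := log_nonneg (by norm_num)
  have hpos : 0 < 1 - s * h := by nlinarith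
  rw [norm_neg, norm_neg, Real.norm_eq_abs, Real.norm_eq_abs, abs_le]
  constructor
  · rcases le_or_gt 0 h with h2 | h2
    · have := log_le_log (by linarith : 0 < 1 - h) (by nlinarith : 1 - h ≤ 1 - s * h)
      linarith [neg_abs_le (log (1 - h))]
    · have := log_nonneg (by nlinarith : 1 ≤ 1 - s * h)
      linarith [abs_nonneg (log (1 - h))]
  · have := log_le_log hpos (by nlinarith : 1 - s * h ≤ 2)
    linarith [abs_nonneg (log (1 - h))]

/-- The logarithmic kernel is positive definite on neutral densities. -/
theorem mutualEnergy_self_nonneg {w : S2 → ℝ} (hw : BoundedMeasurable w)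
    (h0 : ∫ x, w x ∂surface = 0) : 0 ≤ mutualEnergy w w := by
  have hww : Integrable (fun z : S2 × S2 => w z.1 * w z.2) (surface.prod surface) :=
    hw.integrable.mul_prod hw.integrable
  have hK := hw.integrable_mutualEnergy hw
  have hlog : (fun z : S2 × S2 => -log (1 - height z.1 z.2) * (w z.1 * w z.2))
      =ᵐ[surface.prod surface] fun z => 2 * (kernel z.1 z.2 * (w z.1 * w z.2)) +
        log 2 * (w z.1 * w z.2) := by
    filter_upwards [ae_height_lt_one] with z hz
    rw [kernel_eq_log hz]; ring
  have hi := (integrable_congr hlog).2 ((hK.const_mul 2).add (hww.const_mul (log 2)))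
  have hlim : Filter.Tendsto (fun s : ℝ => ∫ z : S2 × S2,
      -log (1 - s * height z.1 z.2) * (w z.1 * w z.2) ∂(surface.prod surface))
      (nhdsWithin 1 (Iio 1)) (nhds (∫ z : S2 × S2,
        -log (1 - height z.1 z.2) * (w z.1 * w z.2) ∂(surface.prod surface))) := by
    refine tendsto_integral_filter_of_dominated_convergence
      (fun z => log 2 * ‖w z.1 * w z.2‖ + ‖-log (1 - height z.1 z.2) * (w z.1 * w z.2)‖)
      ?_ ?_ ((hww.norm.const_mul _).add hi.norm) ?_
    · refine Filter.Eventually.of_forall fun s => ?_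
      exact (((measurable_log.comp (measurable_const.sub
        (continuous_height.measurable.const_mul s))).neg).mul
        ((hw.1.comp measurable_fst).mul (hw.1.comp measurable_snd))).aestronglyMeasurable
    · filter_upwards [self_mem_nhdsWithin, nhdsWithin_le_nhds (Ioi_mem_nhds zero_lt_one)]
        with s hs1 hs0
      filter_upwards [ae_height_lt_one] with z hz
      rw [norm_mul, norm_mul (-log (1 - height z.1 z.2)), ← add_mul]
      exact mul_le_mul_of_nonneg_right (norm_log_le (le_of_lt hs0) (le_of_lt hs1)
        (abs_le.1 (abs_height_le z.1 z.2)).1 hz) (norm_nonneg _)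
    · filter_upwards [ae_height_lt_one] with z hz
      have hc : ContinuousAt (fun s : ℝ => -log (1 - s * height z.1 z.2) * (w z.1 * w z.2)) 1 := by
        refine ContinuousAt.mul (ContinuousAt.neg (ContinuousAt.log (by fun_prop) ?_))
          continuousAt_const
        rw [one_mul]; linarith
      have := hc.tendsto.mono_left (nhdsWithin_le_nhds (s := Iio 1))
      simpa only [one_mul] using this
  have hnn := ge_of_tendsto hlim (b := 0) (by
    filter_upwards [self_mem_nhdsWithin, nhdsWithin_le_nhds (Ioi_mem_nhds zero_lt_one)]
      with s hs1 hs0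
    exact integral_neg_log_nonneg (le_of_lt hs0) hs1 hw)
  -- The additive constant `log 2` contributes a multiple of `(∫ w)²`, which neutrality kills.
  rw [integral_congr_ae hlog, integral_add (hK.const_mul 2) (hww.const_mul (log 2)),
    integral_const_mul, integral_const_mul, integral_prod_mul, h0] at hnn
  rw [mutualEnergy]
  linarith

/-! ### Bilinearity and the lower bound -/

theorem mutualEnergy_comm (f g : S2 → ℝ) : mutualEnergy f g = mutualEnergy g f := by
  rw [mutualEnergy, mutualEnergy, ← integral_prod_swap]
  congr 1
  ext z
  simp only [Prod.fst_swap, Prod.snd_swap]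
  rw [kernel_comm, mul_comm (f _)]

theorem mutualEnergy_sub_left {f g h : S2 → ℝ} (hf : BoundedMeasurable f)
    (hg : BoundedMeasurable g) (hh : BoundedMeasurable h) :
    mutualEnergy (fun x => f x - g x) h = mutualEnergy f h - mutualEnergy g h := by
  rw [mutualEnergy, mutualEnergy, mutualEnergy,
    ← integral_sub (hf.integrable_mutualEnergy hh) (hg.integrable_mutualEnergy hh)]
  simp only [sub_mul, mul_sub]

theorem mutualEnergy_sum_left {ι : Type*} (s : Finset ι) {f : ι → S2 → ℝ} {h : S2 → ℝ}
    (hf : ∀ i, BoundedMeasurable (f i)) (hh : BoundedMeasurable h) :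
    mutualEnergy (fun x => ∑ i ∈ s, f i x) h = ∑ i ∈ s, mutualEnergy (f i) h := by
  simp only [mutualEnergy]
  rw [← integral_finsetSum _ fun i _ => (hf i).integrable_mutualEnergy hh]
  simp only [Finset.sum_mul, Finset.mul_sum]

theorem mutualEnergy_one {f : S2 → ℝ} (hf : BoundedMeasurable f) :
    mutualEnergy f (fun _ => 1) = 4 * π * (1 / 2 - log 2) * ∫ x, f x ∂surface := by
  have hi := hf.integrable_mutualEnergy (boundedMeasurable_const 1)
  simp only [mul_one] at hi
  simp only [mutualEnergy, mul_one]
  rw [integral_prod _ hi, ← integral_const_mul]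
  simp only [integral_mul_const, integral_kernel]

theorem energy_lower_bound {N : ℕ} (hN : 2 ≤ N) {p : Fin N → S2} (hp : Function.Injective p) :
    (1 / 2 - log 2) * (N : ℝ) ^ 2 - 1 / 2 * N * log N + (log 2 - 3 / 4) * N +
      N / 2 * log (1 - 1 / N) ≤ energy p := by
  have hN' : (2 : ℝ) ≤ N := by exact_mod_cast hN
  have hN0 : (0 : ℝ) < N := by linarith
  -- Each cap gets area `2π a = 4π / N`; `2 ≤ N` ensures `a ≤ 1`.
  set a : ℝ := 2 / N with ha_def
  have ha0 : 0 < a := by positivity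
  have ha : a ≤ 1 := by rw [ha_def, div_le_one hN0]; exact hN'
  have hNa : N * a = 2 := by rw [ha_def]; field_simp
  have hcap := fun i => boundedMeasurable_cap a (p i)
  have hone := boundedMeasurable_const 1
  have hsum := BoundedMeasurable.sum Finset.univ hcap
  have hint : ∫ x, ∑ i, cap a (p i) x ∂surface = 4 * π := by
    rw [integral_finsetSum _ fun i _ => integrable_cap a (p i)]
    simp only [integral_cap ha0.le (by linarith : a ≤ 2), Finset.sum_const, Finset.card_univ,
      Fintype.card_fin, nsmul_eq_mul]
    linear_combination 2 * π * hNa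
  have h1 := mutualEnergy_self_nonneg (hsum.sub hone) (by
    rw [integral_sub hsum.integrable hone.integrable, hint]
    simp [surface_real_univ])
  -- Both cross terms equal the energy of `1`, so positivity says that the sum of caps has at least
  -- that energy.
  rw [mutualEnergy_sub_left hsum hone (hsum.sub hone), mutualEnergy_comm,
    mutualEnergy_comm (fun _ => 1), mutualEnergy_sub_left hsum hone hsum,
    mutualEnergy_sub_left hsum hone hone, mutualEnergy_comm (fun _ => 1) (fun x => ∑ i, _),
    mutualEnergy_one hsum, mutualEnergy_one hone, hint, mutualEnergy_sum_left _ hcap hsum] at h1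
  simp only [integral_const, surface_real_univ, smul_eq_mul, mul_one] at h1
  set δ := a / (4 * (2 - a)) with hδ
  set e := -(log (2 - a) / 2) - log a / 2 + 1 / 4 with he
  have h2 : ∀ i, mutualEnergy (cap a (p i)) (fun x => ∑ j, cap a (p j) x) ≤
      (2 * π * a) ^ 2 * (e + (∑ j ∈ Finset.univ.filter (fun j => j ≠ i), kernel (p i) (p j)) +
        (N - 1) * (2 * δ)) := by
    intro i
    rw [mutualEnergy_comm, mutualEnergy_sum_left _ hcap (hcap i),
      ← Finset.add_sum_erase _ _ (Finset.mem_univ i)]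
    have h3 : ∑ j ∈ Finset.univ.erase i, mutualEnergy (cap a (p j)) (cap a (p i)) ≤
        ∑ j ∈ Finset.univ.erase i, (2 * π * a) ^ 2 * (kernel (p i) (p j) + 2 * δ) := by
      refine Finset.sum_le_sum fun j hj => ?_
      rw [mutualEnergy_comm]
      exact mutualEnergy_cap_le ha0 ha (hp.ne (Finset.ne_of_mem_erase hj).symm)
    have h4 := mutualEnergy_cap_self_le ha0 ha (p i)
    rw [← Finset.mul_sum, Finset.sum_add_distrib, Finset.sum_const,
      Finset.card_erase_of_mem (Finset.mem_univ i), Finset.card_univ, Fintype.card_fin,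
      nsmul_eq_mul, Nat.cast_sub (by omega), Nat.cast_one] at h3
    rw [Finset.filter_ne']
    refine (add_le_add h4 h3).trans (le_of_eq ?_)
    rw [he]; ring
  have h5 := Finset.sum_le_sum fun i (_ : i ∈ Finset.univ) => h2 i
  rw [← Finset.mul_sum, Finset.sum_add_distrib, Finset.sum_add_distrib, Finset.sum_const,
    Finset.sum_const, Finset.card_univ, Fintype.card_fin, nsmul_eq_mul, nsmul_eq_mul] at h5
  have h6 : (4 * π) ^ 2 * (1 / 2 - log 2) ≤
      (2 * π * a) ^ 2 * (N * e + energy p + N * ((N - 1) * (2 * δ))) := by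
    refine le_trans ?_ h5
    linarith
  have h7 : (4 * π) ^ 2 = (2 * π * a) ^ 2 * N ^ 2 := by
    linear_combination (-(4 * π ^ 2) * (N * a + 2)) * hNa
  rw [h7, mul_assoc, mul_le_mul_iff_right₀ (by positivity)] at h6
  -- With `a = 2 / N`, `δ = 1 / (4 (N - 1))`.
  have h8 : N * ((N - 1) * (2 * δ)) = N / 2 := by
    have : (N : ℝ) - 1 ≠ 0 := by linarith
    have h9 : 2 - a = 2 * (N - 1) / N := by rw [ha_def]; field_simp
    rw [hδ, h9, ha_def]
    field_simp
    norm_num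
  have h10 : e = log N / 2 - log 2 - log (1 - 1 / N) / 2 + 1 / 4 := by
    have h11 : 2 - a = 2 * (1 - 1 / N) := by rw [ha_def]; ring
    have h12 : 1 - 1 / (N : ℝ) ≠ 0 := by
      rw [one_sub_div hN0.ne']
      exact (div_pos (by linarith) hN0).ne'
    rw [he, h11, log_mul (by norm_num) h12, ha_def, log_div (by norm_num) hN0.ne']
    ring
  rw [h8, h10] at h6
  linarith

/-! ### The error term and the bound on `C_log` -/

theorem tendsto_log_one_sub_inv :
    Filter.Tendsto (fun N : ℕ => log (1 - 1 / (N : ℝ))) Filter.atTop (nhds 0) := by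
  have h : Filter.Tendsto (fun N : ℕ => 1 - 1 / (N : ℝ)) Filter.atTop (nhds (1 - 0)) :=
    tendsto_const_nhds.sub tendsto_one_div_atTop_nhds_zero_nat
  rw [sub_zero] at h
  have h2 := (continuousAt_log one_ne_zero).tendsto.comp h
  rwa [log_one] at h2

theorem isLittleO_error :
    (fun N : ℕ => (N : ℝ) / 2 * log (1 - 1 / N)) =o[Filter.atTop] (fun N : ℕ => (N : ℝ)) := by
  have h := tendsto_log_one_sub_inv.div_const 2
  rw [zero_div] at h
  have h2 := (Asymptotics.isBigO_refl (fun N : ℕ => (N : ℝ)) Filter.atTop).mul_isLittleO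
    ((Asymptotics.isLittleO_one_iff ℝ).2 h)
  simp only [mul_one] at h2
  refine h2.congr_left fun N => ?_
  ring

theorem energy_lower_bound_all (N : ℕ) {p : Fin N → S2} (hp : Function.Injective p) :
    kappa * (N : ℝ) ^ 2 - 1 / 2 * (N : ℝ) * log N + (log 2 - 3 / 4) * (N : ℝ) +
      (N : ℝ) / 2 * log (1 - 1 / N) ≤ energy p := by
  rw [kappa_eq]
  rcases lt_or_ge N 2 with h | h
  -- For `N = 0` both sides vanish. For `N = 1` the error term is `0` since `log 0 = 0`, and the
  -- claim is `-1/4 ≤ 0`.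
  · interval_cases N
    · simp [energy]
    · have : energy p = 0 := by
        simp [energy, Finset.filter_ne']
      rw [this]
      norm_num
  · exact energy_lower_bound h hp

theorem le_of_isClog {C : ℝ} (hC : IsClog C) : log 2 - 3 / 4 ≤ C := by
  -- Both errors are `o(N)`; for a minimizer, their difference over `N` stays at least `log 2 - 3 /
  -- 4 - C` and tends to `0`.
  have h1 := (hC.sub isLittleO_error).tendsto_div_nhds_zero
  have h2 : ∀ᶠ N : ℕ in Filter.atTop, (log 2 - 3 / 4) - C ≤
      ((minEnergy N - (kappa * (N : ℝ) ^ 2 - 1 / 2 * (N : ℝ) * log N + C * N)) -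
        (N : ℝ) / 2 * log (1 - 1 / N)) / N := by
    filter_upwards [Filter.eventually_gt_atTop 0] with N hN
    obtain ⟨p, hp, he⟩ := (isLeast_minEnergy N).1
    have h3 := energy_lower_bound_all N hp
    rw [he] at h3
    rw [le_div_iff₀ (by exact_mod_cast hN)]
    linarith
  have := ge_of_tendsto h1 h2
  linarith

end LogEnergy

theorem mainTheorem1 :
    (MeasureTheory.Integrable (fun z : LogEnergy.S2 × LogEnergy.S2 => LogEnergy.kernel z.1 z.2)
        (LogEnergy.surface.prod LogEnergy.surface) ∧
      LogEnergy.kappa = 1 / 2 - Real.log 2) ∧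
    (∃ r : ℕ → ℝ, r =o[Filter.atTop] (fun N : ℕ => (N : ℝ)) ∧
      ∀ (N : ℕ) (p : Fin N → LogEnergy.S2), Function.Injective p →
        LogEnergy.kappa * (N : ℝ) ^ 2 - 1 / 2 * (N : ℝ) * Real.log N
          + (Real.log 2 - 3 / 4) * (N : ℝ) + r N ≤ LogEnergy.energy p) ∧
    (∀ C : ℝ, LogEnergy.IsClog C → Real.log 2 - 3 / 4 ≤ C) :=
  ⟨⟨LogEnergy.integrable_kernel_prod, LogEnergy.kappa_eq⟩,
    ⟨_, LogEnergy.isLittleO_error, fun N _ hp => LogEnergy.energy_lower_bound_all N hp⟩,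
    fun _ hC => LogEnergy.le_of_isClog hC⟩
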